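/- Let $M$ be a (non-empty) compact, connected, locally connected Hausdorff space. For a continuous $\varphi:M\to\mathbb{R}$, two points of $M$ are called $\langle\varphi\le y\rangle$-connected if some connected subset of $\{P\in M:\varphi(P)\le y\}$ contains both. The reduced size function $\ell^*_{(M,\varphi)}$ is the function on $\Delta^+=\{(x,y)\in\mathbb{R}^2:x<y\}$ whose value at $(x,y)$ is the (finite) number of equivalence classes into which $\{P\in M:\varphi(P)\le x\}$ is divided by $\langle\varphi\le y\rangle$-connectedness. For a reduced size function $\ell^*$, the multiplicity $\mu(p)$ of $p=(x,y)\in\Delta^+$ is the minimum, over all real $\eta>0$ with $x+\eta<y-\eta$, of $$\ell^*(x+\eta,y-\eta)-\ell^*(x-\eta,y-\eta)-\ell^*(x+\eta,y+\eta)+\ell^*(x-\eta,y+\eta),$$ and $p$ is a proper cornerpoint if $\mu(p)>0$. The pair $(k,\infty)$, $k\in\mathbb{R}$, is a cornerpoint at infinity if the minimum of $\ell^*(k+\eta,1/\eta)-\ell^*(k-\eta,1/\eta)$ over all real $\eta>0$ with $k+\eta<1/\eta$ is positive; since $M$ is connected, there is exactly one. Let $\Delta=\{(x,y)\in\mathbb{R}^2:x=y\}$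 and $\bar\Delta^*=\{(x,y)\in\mathbb{R}^2:x\le y\}\cup\{(k,\infty):k\in\mathbb{R}\}$, and define $d$ on $\bar\Delta^*$ by $$d\big((x,y),(x',y')\big)=\min\Big\{\max\{|x-x'|,|y-y'|\},\ \max\big\{\tfrac{y-x}{2},\tfrac{y'-x'}{2}\big\}\Big\},$$ with $\infty-\infty=0$, $|\infty-y|=|y-\infty|=\infty$ and $\infty-y=\infty$ for real $y$, $\infty/2=\infty$. A representative sequence for $\ell^*$ is a sequence $(a_i)_{i\in\mathbb{N}}$ in $\bar\Delta^*$ (with $0\in\mathbb{N}$) such that $a_0$ is the cornerpoint at infinity of $\ell^*$; for each $i>0$, $a_i$ is a proper cornerpoint of $\ell^*$ or lies on $\Delta$; every proper cornerpoint $p$ satisfies $\#\{i:a_i=p\}=\mu(p)$; and $a_i\in\Delta$ for infinitely many $i$. The matching distance between $\ell^*_1$ and $\ell^*_2$ is $$d_{match}(\ell^*_1,\ell^*_2)=\inf_\sigma\sup_{i\in\mathbb{N}}d(a_i,b_{\sigma(i)}),$$ where $(a_i)$, $(b_i)$ are representative sequences for $\ell^*_1$, $\ell^*_2$ and $\sigma$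 ranges over all bijections $\mathbb{N}\to\mathbb{N}$. **Theorem (Matching Stability Theorem).** Let $M$ be as above and let $\varphi:M\to\mathbb{R}$ be continuous. For every real $\varepsilon\ge0$ and every continuous $\psi:M\to\mathbb{R}$ with $\max_{P\in M}|\varphi(P)-\psi(P)|\le\varepsilon$, the matching distance between $\ell^*_{(M,\varphi)}$ and $\ell^*_{(M,\psi)}$ is well defined (both functions have representative sequences, and the number above is finite and does not depend on their choice), and $$d_{match}\big(\ell^*_{(M,\varphi)},\ell^*_{(M,\psi)}\big)\le\varepsilon.$$ -/

import Mathlib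

open scoped NNReal ENNReal

namespace SizeTheory

/-- Two points are `⟨φ ≤ y⟩`-connected if some connected subset of the lower level set
`{R | φ R ≤ y}` contains both. -/
def SublevelConnected {M : Type*} [TopologicalSpace M] (φ : M → ℝ) (y : ℝ) (P Q : M) : Prop :=
  ∃ C : Set M, IsConnected C ∧ C ⊆ {R | φ R ≤ y} ∧ P ∈ C ∧ Q ∈ C

/-- The classes of the lower level set `{φ ≤ x}` under `⟨φ ≤ y⟩`-connectedness. -/
def sublevelClasses {M : Type*} [TopologicalSpace M] (φ : M → ℝ) (x y : ℝ) : Set (Set M) :=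
  {c | ∃ P, φ P ≤ x ∧ c = {Q | φ Q ≤ x ∧ SublevelConnected φ y P Q}}

/-- For `x ≤ y`, `⟨φ ≤ y⟩`-connectedness is an equivalence relation on `{φ ≤ x}`. -/
theorem sublevelConnected_equivalence {M : Type*} [TopologicalSpace M] (φ : M → ℝ) {x y : ℝ}
    (hxy : x ≤ y) :
    Equivalence (fun P Q : {P : M // φ P ≤ x} => SublevelConnected φ y P.1 Q.1) where
  refl P := ⟨{P.1}, isConnected_singleton, by
    rintro R rfl
    exact P.2.trans hxy, rfl, rfl⟩
  symm := fun ⟨C, hC, hs, hP, hQ⟩ => ⟨C, hC, hs, hQ, hP⟩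
  trans := fun ⟨C, hC, hs, hP, hQ⟩ ⟨D, hD, ht, hQ', hR⟩ =>
    ⟨C ∪ D, hC.union ⟨_, hQ, hQ'⟩ hD, Set.union_subset hs ht, Or.inl hP, Or.inr hR⟩

/-- On `x < y` the number of classes is finite, so that counting them with `Set.ncard`
gives their true number. -/
theorem sublevelClasses_finite {M : Type*} [TopologicalSpace M] [CompactSpace M]
    [LocallyConnectedSpace M] {φ : M → ℝ} (hφ : Continuous φ) {x y : ℝ} (hxy : x < y) :
    (sublevelClasses φ x y).Finite := by
  have hK : IsCompact {P : M | φ P ≤ x} := (isClosed_le hφ continuous_const).isCompact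
  have hO : IsOpen {P : M | φ P < y} := isOpen_lt hφ continuous_const
  obtain ⟨t, ht, hcov⟩ := hK.elim_nhds_subcover
    (fun P => connectedComponentIn {P : M | φ P < y} P) (fun P hP =>
      (hO.connectedComponentIn).mem_nhds (mem_connectedComponentIn (show φ P < y from lt_of_le_of_lt hP hxy)))
  refine ((t : Set M).toFinite.image
    (fun P => {Q | φ Q ≤ x ∧ SublevelConnected φ y P Q})).subset ?_
  rintro c ⟨P, hP, rfl⟩
  obtain ⟨R, hR, hPR⟩ := Set.mem_iUnion₂.1 (hcov hP)
  have hRx : φ R ≤ x := ht R hR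
  have hRO : R ∈ {P : M | φ P < y} := hRx.trans_lt hxy
  have hRP : SublevelConnected φ y R P :=
    ⟨_, isConnected_connectedComponentIn_iff.2 hRO,
      (connectedComponentIn_subset _ _).trans fun S (hS : φ S < y) => hS.le,
      mem_connectedComponentIn hRO, hPR⟩
  have E := sublevelConnected_equivalence φ hxy.le
  refine ⟨R, hR, ?_⟩
  ext Q
  constructor
  · rintro ⟨hQ, h⟩
    exact ⟨hQ, E.trans (x := ⟨P, hP⟩) (y := ⟨R, hRx⟩) (z := ⟨Q, hQ⟩)
      (E.symm (x := ⟨R, hRx⟩) (y := ⟨P, hP⟩) hRP) h⟩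
  · rintro ⟨hQ, h⟩
    exact ⟨hQ, E.trans (x := ⟨R, hRx⟩) (y := ⟨P, hP⟩) (z := ⟨Q, hQ⟩) hRP h⟩

/-- The reduced size function of `(M, φ)`: the number of classes into which `{φ ≤ x}` is divided
by `⟨φ ≤ y⟩`-connectedness. It is only ever evaluated on the open half-plane `x < y`. -/
noncomputable def reducedSizeFunction {M : Type*} [TopologicalSpace M] (φ : M → ℝ)
    (x y : ℝ) : ℕ :=
  (sublevelClasses φ x y).ncard

/-- The multiplicity of the point `(x, y)`, `x < y`: the minimum over all `ε > 0` with
`x + ε < y - ε` of the alternating sum of `ℓ` over the vertices of the square of radius `ε`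
about `(x, y)`. -/
noncomputable def cornerMultiplicity (ℓ : ℝ → ℝ → ℕ) (x y : ℝ) : ℤ :=
  sInf {n : ℤ | ∃ ε : ℝ, 0 < ε ∧ x + ε < y - ε ∧
    n = (ℓ (x + ε) (y - ε) : ℤ) - ℓ (x - ε) (y - ε) - ℓ (x + ε) (y + ε) + ℓ (x - ε) (y + ε)}

/-- The multiplicity of the vertical line with abscissa `k`, i.e. of the point `(k, ∞)`. -/
noncomputable def multiplicityAtInfinity (ℓ : ℝ → ℝ → ℕ) (k : ℝ) : ℤ :=
  sInf {n : ℤ | ∃ ε : ℝ, 0 < ε ∧ k + ε < 1 / ε ∧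
    n = (ℓ (k + ε) (1 / ε) : ℤ) - ℓ (k - ε) (1 / ε)}

/-- `(x, y)` is a proper cornerpoint of `ℓ`. -/
def IsProperCornerpoint (ℓ : ℝ → ℝ → ℕ) (x y : ℝ) : Prop :=
  x < y ∧ 0 < cornerMultiplicity ℓ x y

/-- `(k, ∞)` is a cornerpoint at infinity of `ℓ`. -/
def IsCornerpointAtInfinity (ℓ : ℝ → ℝ → ℕ) (k : ℝ) : Prop :=
  0 < multiplicityAtInfinity ℓ k

/-- The closed half-plane `{(x, y) | x ≤ y}` extended by the points at infinity `(k, ∞)`. -/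
inductive ExtPoint : Type
  | finite (x y : ℝ) (h : x ≤ y) : ExtPoint
  | infinite (k : ℝ) : ExtPoint

/-- The point lies on the diagonal. -/
def ExtPoint.OnDiagonal (p : ExtPoint) : Prop :=
  ∃ x : ℝ, p = .finite x x le_rfl

/-- The pseudo-distance
`min (max |x - x'| |y - y'|) (max ((y - x) / 2) ((y' - x') / 2))` on the extended half-plane,
with `|∞ - ∞| = 0`, `|∞ - y| = ∞` and `∞ / 2 = ∞`. -/
noncomputable def ExtPoint.dist : ExtPoint → ExtPoint → ℝ≥0∞
  | .finite x y _, .finite x' y' _ =>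
      ENNReal.ofReal (min (max |x - x'| |y - y'|) (max ((y - x) / 2) ((y' - x') / 2)))
  | .infinite k, .infinite k' => ENNReal.ofReal |k - k'|
  | .finite _ _ _, .infinite _ => ⊤
  | .infinite _, .finite _ _ _ => ⊤

/-- Representative sequences of a reduced size function. -/
structure IsRepresentativeSequence (ℓ : ℝ → ℝ → ℕ) (a : ℕ → ExtPoint) : Prop where
  zero : ∃ k, IsCornerpointAtInfinity ℓ k ∧ a 0 = .infinite k
  pos : ∀ i, 0 < i →
    (∃ (x y : ℝ) (h : x ≤ y), IsProperCornerpoint ℓ x y ∧ a i = .finite x y h) ∨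
      (a i).OnDiagonal
  /- the multiplicity here is positive, so the counted set is automatically finite -/
  card_eq : ∀ (x y : ℝ) (h : x ≤ y), IsProperCornerpoint ℓ x y →
    ({i | a i = .finite x y h}.ncard : ℤ) = cornerMultiplicity ℓ x y
  diagonal : {i | (a i).OnDiagonal}.Infinite

/-- The infimum over all bijections of the supremal displacement. -/
noncomputable def matchingCost (a b : ℕ → ExtPoint) : ℝ≥0∞ :=
  ⨅ σ : ℕ ≃ ℕ, ⨆ i, (a i).dist (b (σ i))

/-- `r` is the matching distance between `ℓ₁` and `ℓ₂`: both have representative sequences, and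
`r` is the matching cost of every pair of representative sequences. There is at most one
such `r`. -/
def IsMatchingDistance (ℓ₁ ℓ₂ : ℝ → ℝ → ℕ) (r : ℝ≥0) : Prop :=
  (∃ a, IsRepresentativeSequence ℓ₁ a) ∧ (∃ b, IsRepresentativeSequence ℓ₂ b) ∧
    ∀ a b, IsRepresentativeSequence ℓ₁ a → IsRepresentativeSequence ℓ₂ b →
      matchingCost a b = r

end SizeTheory

/-! The proof interpolates between `φ` and `ψ` by a mixed count: the components of `{ψ - ε ≤ y}` met
by `{φ ≤ x}`. All counts are diminished by one when non-zero; as `M` is connected they then vanish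
for large `y`, which removes the cornerpoint at infinity and keeps the other multiplicities. By
`excessComponents_add_le` each such `excess` has non-negative box sums, and `exists_fibre_eq_Ico`
turns it into a multiset of cornerpoints listed along verticals by abscissa and rank; reflection
lists them along horizontals.

Since `{φ ≤ y} ⊆ {ψ - ε ≤ y} ⊆ {φ ≤ y + 2ε}`, `persists_comparison` sends a mixed cornerpoint `(b,
d)` to a cornerpoint `(b, d')` of `φ` with `d ≤ d' ≤ d + 2ε`. Applied after reflection, it sends
`(b, d)` to a cornerpoint `(b', d + ε)` of `ψ` with `|b' - b| ≤ ε`. The two images are within `ε` of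
each other. Cornerpoints of `φ` or `ψ` that are not hit satisfy `y - x ≤ 2ε`, so any two of them are
at distance at most `ε`. The points at infinity are the minima of `φ` and `ψ`, which differ by at
most `ε`.

The cost does not depend on the sequences: by `Represents.exists_equiv` two representing families
agree up to a bijection and a change of diagonal points, which `dist` does not see. -/

namespace SizeTheory

/-! ### Counting values and components -/

/-- If `g` factors through `f` on `t`, then enlarging `s` to `t` creates at least as many new
values of `f` as of `g`. -/
theorem ncard_image_add_ncard_image_le {α β γ : Type*} (f : α → β) (g : α → γ) {s t : Set α}
    (hst : s ⊆ t) (hf : (f '' t).Finite)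
    (hfg : ∀ P ∈ t, ∀ Q ∈ t, f P = f Q → g P = g Q) :
    (g '' t).Finite ∧
      (g '' t).ncard + (f '' s).ncard ≤ (f '' t).ncard + (g '' s).ncard := by
  classical
  rcases t.eq_empty_or_nonempty with rfl | ⟨P₀, hP₀⟩
  · obtain rfl : s = ∅ := Set.subset_empty_iff.1 hst
    simp
  obtain ⟨k, hk⟩ : ∃ k : β → γ, ∀ P ∈ t, k (f P) = g P := by
    refine ⟨fun b => if hb : ∃ P ∈ t, f P = b then g hb.choose else g P₀, fun P hP => ?_⟩
    have hb : ∃ Q ∈ t, f Q = f P := ⟨P, hP, rfl⟩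
    simp only [dif_pos hb]
    exact hfg _ hb.choose_spec.1 _ hP hb.choose_spec.2
  have hsub : g '' t ⊆ k '' (f '' t) := by
    rintro _ ⟨P, hP, rfl⟩
    exact ⟨_, ⟨P, hP, rfl⟩, hk P hP⟩
  have hg : (g '' t).Finite := (hf.image k).subset hsub
  refine ⟨hg, ?_⟩
  have h₁ : (g '' t \ g '' s).ncard ≤ (f '' t \ f '' s).ncard := by
    refine (Set.ncard_le_ncard (t := k '' (f '' t \ f '' s)) ?_ (hf.sdiff.image k)).trans
      (Set.ncard_image_le hf.sdiff)
    rintro _ ⟨⟨P, hP, rfl⟩, hn⟩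
    refine ⟨_, ⟨⟨P, hP, rfl⟩, ?_⟩, hk P hP⟩
    rintro ⟨Q, hQ, h⟩
    exact hn ⟨Q, hQ, hfg _ (hst hQ) _ hP h⟩
  have h₂ := Set.ncard_sdiff_add_ncard_of_subset (Set.image_mono (f := g) hst) hg
  have h₃ := Set.ncard_sdiff_add_ncard_of_subset (Set.image_mono (f := f) hst) hf
  omega

theorem ncard_image_congr {α β γ : Type*} (f : α → β) (g : α → γ) {t : Set α}
    (hf : (f '' t).Finite) (hfg : ∀ P ∈ t, ∀ Q ∈ t, (f P = f Q ↔ g P = g Q)) :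
    (g '' t).ncard = (f '' t).ncard := by
  have h := ncard_image_add_ncard_image_le f g (Set.empty_subset t) hf
    fun P hP Q hQ => (hfg P hP Q hQ).1
  have h' := ncard_image_add_ncard_image_le g f (Set.empty_subset t) h.1
    fun P hP Q hQ => (hfg P hP Q hQ).2
  have h₁ := h.2
  have h₂ := h'.2
  simp only [Set.image_empty, Set.ncard_empty] at h₁ h₂
  omega

section Topology

variable {M : Type*} [TopologicalSpace M]

/-- The number of components of `F` met by `X`, diminished by one if `X` is non-empty. -/
noncomputable def excessComponents (X F : Set M) : ℕ :=
  (connectedComponentIn F '' X).ncard - 1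

theorem connectedComponentIn_eq_of_subset {F G : Set M} (hFG : F ⊆ G) {P Q : M} (hP : P ∈ F)
    (h : connectedComponentIn F P = connectedComponentIn F Q) :
    connectedComponentIn G P = connectedComponentIn G Q := by
  have : P ∈ connectedComponentIn F Q := h ▸ mem_connectedComponentIn hP
  exact (connectedComponentIn_eq (connectedComponentIn_mono Q hFG this)).symm

/-- Components of the open set `U` are open, so finitely many cover `X`, and each lies in a single
component of `F`. -/
theorem finite_connectedComponentIn_image [LocallyConnectedSpace M] {X U F : Set M}
    (hX : IsCompact X) (hU : IsOpen U) (hXU : X ⊆ U) (hUF : U ⊆ F) :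
    (connectedComponentIn F '' X).Finite := by
  obtain ⟨t, ht, hcov⟩ := hX.elim_nhds_subcover (fun P => connectedComponentIn U P)
    fun P hP => hU.connectedComponentIn.mem_nhds (mem_connectedComponentIn (hXU hP))
  refine (t.finite_toSet.image (connectedComponentIn F)).subset ?_
  rintro _ ⟨P, hP, rfl⟩
  obtain ⟨R, hR, hPR⟩ := Set.mem_iUnion₂.1 (hcov hP)
  exact ⟨R, hR, connectedComponentIn_eq (connectedComponentIn_mono R hUF hPR)⟩

/-- A component of `G` met by `Y` but not by `X` contains a component of `F` with the same property.
The discount is harmless: for non-empty `X` all four counts drop by one, and for empty `X` the two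
terms in `X` are zero by truncation. -/
theorem excessComponents_add_le {X Y F G : Set M} (hXY : X ⊆ Y) (hYF : Y ⊆ F) (hFG : F ⊆ G)
    (hfin : (connectedComponentIn F '' Y).Finite) :
    excessComponents Y G + excessComponents X F ≤
      excessComponents Y F + excessComponents X G := by
  have hfg : ∀ P ∈ Y, ∀ Q ∈ Y, connectedComponentIn F P = connectedComponentIn F Q →
      connectedComponentIn G P = connectedComponentIn G Q :=
    fun P hP Q _ => connectedComponentIn_eq_of_subset hFG (hYF hP)
  obtain ⟨hg, h⟩ := ncard_image_add_ncard_image_le _ _ hXY hfin hfg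
  have pos : ∀ {Z E : Set M}, (connectedComponentIn E '' Z).Finite → Z.Nonempty →
      0 < (connectedComponentIn E '' Z).ncard :=
    fun hf hZ => (Set.ncard_pos hf).2 (hZ.image _)
  unfold excessComponents
  rcases X.eq_empty_or_nonempty with rfl | hX
  · simp only [Set.image_empty, Set.ncard_empty] at h ⊢
    omega
  · have h₁ := pos hfin (hX.mono hXY)
    have h₂ := pos hg (hX.mono hXY)
    have h₃ := pos (hfin.subset (Set.image_mono hXY)) hX
    have h₄ := pos (hg.subset (Set.image_mono hXY)) hX
    omega

/-- The excess count of the classes of `{φ ≤ x}` under `⟨ψ ≤ y⟩`-connectedness. -/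
noncomputable def excess (φ ψ : M → ℝ) (x y : ℝ) : ℕ :=
  excessComponents {P | φ P ≤ x} {P | ψ P ≤ y}

variable [CompactSpace M] [LocallyConnectedSpace M]

theorem finite_components_sublevel {φ ψ : M → ℝ} (hφ : Continuous φ) (hψ : Continuous ψ)
    {x y : ℝ} (h : ∀ P, φ P ≤ x → ψ P < y) :
    (connectedComponentIn {P | ψ P ≤ y} '' {P | φ P ≤ x}).Finite :=
  finite_connectedComponentIn_image (isClosed_le hφ continuous_const).isCompact
    (isOpen_lt hψ continuous_const) h fun P (hP : ψ P < y) => hP.le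

/-- The classes are the traces on `{φ ≤ x}` of the components of `{φ ≤ y}` that meet it, and
distinct components have distinct traces. -/
theorem reducedSizeFunction_eq_ncard {φ : M → ℝ} (hφ : Continuous φ) {x y : ℝ} (hxy : x < y) :
    reducedSizeFunction φ x y =
      (connectedComponentIn {P | φ P ≤ y} '' {P | φ P ≤ x}).ncard := by
  have key : ∀ P Q : M, φ P ≤ x → (SublevelConnected φ y P Q ↔
      Q ∈ connectedComponentIn {P | φ P ≤ y} P) := by
    intro P Q hP
    constructor
    · rintro ⟨C, hC, hs, h₁, h₂⟩
      exact hC.isPreconnected.subset_connectedComponentIn h₁ hs h₂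
    · intro h
      have hP' : P ∈ {P | φ P ≤ y} := hP.trans hxy.le
      exact ⟨_, isConnected_connectedComponentIn_iff.2 hP', connectedComponentIn_subset _ _,
        mem_connectedComponentIn hP', h⟩
  have himg : sublevelClasses φ x y =
      (fun P => {Q | φ Q ≤ x ∧ SublevelConnected φ y P Q}) '' {P | φ P ≤ x} := by
    ext c
    simp only [sublevelClasses, Set.mem_ofPred_eq, Set.mem_image, eq_comm]
  rw [reducedSizeFunction, himg]
  refine ncard_image_congr _ _ (finite_components_sublevel hφ hφ fun P hP => hP.trans_lt hxy) ?_
  intro P hP Q hQ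
  have hP' : P ∈ {P | φ P ≤ y} := le_trans hP hxy.le
  have hQ' : Q ∈ {P | φ P ≤ y} := le_trans hQ hxy.le
  constructor
  · intro h
    ext R
    simp only [Set.mem_ofPred_eq, key P R hP, key Q R hQ, h]
  · intro h
    have : Q ∈ {R | φ R ≤ x ∧ SublevelConnected φ y Q R} :=
      ⟨hQ, (key Q Q hQ).2 (mem_connectedComponentIn hQ')⟩
    rw [← h] at this
    exact connectedComponentIn_eq ((key P Q hP).1 this.2)

end Topology

/-! ### Rank functions and their cornerpoints -/

/-- An integer-valued function on `x < y` whose alternating sums over boxes are non-negative and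
which vanishes far to the left and far up. -/
structure IsRankFunction (L : ℝ → ℝ → ℕ) : Prop where
  box : ∀ {x₁ x₂ y₁ y₂ : ℝ}, x₁ ≤ x₂ → x₂ < y₁ → y₁ ≤ y₂ →
    L x₂ y₂ + L x₁ y₁ ≤ L x₂ y₁ + L x₁ y₂
  lower : ∃ A, ∀ x y, x < y → x < A → L x y = 0
  upper : ∃ B, ∀ x y, x < y → B < y → L x y = 0

/-- The reflection of a function of the half-plane `x < y` in the line `x + y = 0`. -/
def reflect (L : ℝ → ℝ → ℕ) (x y : ℝ) : ℕ := L (-y) (-x)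

/-- At least `r + 1` cornerpoints with abscissa `b` have ordinate greater than or near `y`. -/
def Persists (L : ℝ → ℝ → ℕ) (b : ℝ) (r : ℕ) (y : ℝ) : Prop :=
  b < y ∧ ∀ η, 0 < η → b + η < y → L (b - η) y + r < L (b + η) y

/-- The cornerpoints, repeated by multiplicity, indexed by abscissa and rank on the vertical. -/
def Row (L : ℝ → ℝ → ℕ) : Type := {p : ℝ × ℕ // ∃ y, Persists L p.1 p.2 y}

/-- The ordinate of the cornerpoint of rank `r` on the vertical with abscissa `b`. -/
noncomputable def death (L : ℝ → ℝ → ℕ) (b : ℝ) (r : ℕ) : ℝ := sSup {y | Persists L b r y}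

/-- The jump of `L · y` at `b`. -/
noncomputable def jump (L : ℝ → ℝ → ℕ) (b y : ℝ) : ℕ :=
  sInf {n | ∃ η, 0 < η ∧ b + η < y ∧ n = L (b + η) y - L (b - η) y}

theorem jump_le {L : ℝ → ℝ → ℕ} {b y η : ℝ} (hη : 0 < η) (h : b + η < y) :
    jump L b y ≤ L (b + η) y - L (b - η) y :=
  Nat.sInf_le ⟨η, hη, h, rfl⟩

theorem exists_jump_eq (L : ℝ → ℝ → ℕ) {b y : ℝ} (h : b < y) :
    ∃ η, 0 < η ∧ b + η < y ∧ L (b + η) y - L (b - η) y = jump L b y := by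
  have : jump L b y ∈ {n | ∃ η, 0 < η ∧ b + η < y ∧ n = L (b + η) y - L (b - η) y} :=
    Nat.sInf_mem ⟨_, (y - b) / 2, by linarith, by linarith, rfl⟩
  obtain ⟨η, h₁, h₂, h₃⟩ := this
  exact ⟨η, h₁, h₂, h₃.symm⟩

theorem persists_iff {L : ℝ → ℝ → ℕ} {b y : ℝ} {r : ℕ} (h : b < y) :
    Persists L b r y ↔ r < jump L b y := by
  constructor
  · rintro ⟨-, H⟩
    obtain ⟨η, h₁, h₂, h₃⟩ := exists_jump_eq L h
    have := H η h₁ h₂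
    omega
  · refine fun H => ⟨h, fun η h₁ h₂ => ?_⟩
    have := jump_le (L := L) h₁ h₂
    omega

theorem cornerMultiplicity_reflect (L : ℝ → ℝ → ℕ) (x y : ℝ) :
    cornerMultiplicity (reflect L) (-y) (-x) = cornerMultiplicity L x y := by
  unfold cornerMultiplicity reflect
  congr 1
  ext n
  refine exists_congr fun ε => and_congr_right fun _ => and_congr ?_ ?_
  · constructor <;> intro h <;> linarith
  · have e₁ : -(-x - ε) = x + ε := by ring
    have e₂ : -(-x + ε) = x - ε := by ring
    have e₃ : -(-y + ε) = y - ε := by ring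
    have e₄ : -(-y - ε) = y + ε := by ring
    rw [e₁, e₂, e₃, e₄]
    constructor <;> intro h <;> linarith

/-- The reflection of the extended half-plane in the line `x + y = 0`. -/
def ExtPoint.reflect : ExtPoint → ExtPoint
  | .finite x y h => .finite (-y) (-x) (neg_le_neg h)
  | .infinite k => .infinite (-k)

theorem ExtPoint.reflect_reflect (p : ExtPoint) : p.reflect.reflect = p := by
  cases p <;> simp [ExtPoint.reflect]

theorem ExtPoint.reflect_eq_iff (p : ExtPoint) {x y : ℝ} (h : x ≤ y) :
    p.reflect = .finite x y h ↔ p = .finite (-y) (-x) (neg_le_neg h) := by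
  constructor
  · intro e
    rw [← p.reflect_reflect, e]
    rfl
  · rintro rfl
    simp [ExtPoint.reflect]

/-- The point of the half-plane indexed by `v`. -/
noncomputable def rowPoint (L : ℝ → ℝ → ℕ) (v : Row L) : ExtPoint :=
  .finite v.1.1 (max v.1.1 (death L v.1.1 v.1.2)) (le_max_left _ _)

namespace IsRankFunction

variable {L : ℝ → ℝ → ℕ} (hL : IsRankFunction L)
include hL

theorem reflect : IsRankFunction (reflect L) where
  box h₁ h₂ h₃ := by
    have := hL.box (neg_le_neg h₃) (neg_lt_neg h₂) (neg_le_neg h₁)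
    simp only [SizeTheory.reflect]
    omega
  lower := by
    obtain ⟨B, hB⟩ := hL.upper
    exact ⟨-B, fun x y h h' => hB _ _ (neg_lt_neg h) (by linarith)⟩
  upper := by
    obtain ⟨A, hA⟩ := hL.lower
    exact ⟨-A, fun x y h h' => hA _ _ (neg_lt_neg h) (by linarith)⟩

/-- This is the box inequality with the upper side placed where `L` vanishes. -/
theorem mono_left {x₁ x₂ y : ℝ} (h : x₁ ≤ x₂) (h' : x₂ < y) : L x₁ y ≤ L x₂ y := by
  obtain ⟨B, hB⟩ := hL.upper
  have hy : y ≤ max y (B + 1) := le_max_left _ _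
  have hB' : B < max y (B + 1) := (lt_add_one B).trans_le (le_max_right _ _)
  have := hL.box h h' hy
  rw [hB x₂ _ (h'.trans_le hy) hB', hB x₁ _ (h.trans_lt (h'.trans_le hy)) hB'] at this
  omega

theorem jump_anti {b y₁ y₂ : ℝ} (h : b < y₁) (h' : y₁ ≤ y₂) : jump L b y₂ ≤ jump L b y₁ := by
  obtain ⟨η, h₁, h₂, h₃⟩ := exists_jump_eq L h
  have := hL.box (show b - η ≤ b + η by linarith) h₂ h'
  have := jump_le (L := L) h₁ (h₂.trans_le h')
  omega

theorem persists_anti {b y₁ y₂ : ℝ} {r : ℕ} (H : Persists L b r y₂) (h : b < y₁)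
    (h' : y₁ ≤ y₂) : Persists L b r y₁ :=
  (persists_iff h).2 (((persists_iff H.1).1 H).trans_le (hL.jump_anti h h'))

theorem bddAbove_persists (b : ℝ) (r : ℕ) : BddAbove {y | Persists L b r y} := by
  obtain ⟨B, hB⟩ := hL.upper
  refine ⟨B, fun y ⟨hy, H⟩ => ?_⟩
  by_contra! h
  have := H ((y - b) / 2) (by linarith) (by linarith)
  rw [hB (b + (y - b) / 2) y (by linarith) h] at this
  omega

theorem le_death {b y : ℝ} {r : ℕ} (H : Persists L b r y) : y ≤ death L b r :=
  le_csSup (hL.bddAbove_persists b r) H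

theorem persists_of_lt_death {b y y' : ℝ} {r : ℕ} (H : Persists L b r y') (h : b < y)
    (h' : y < death L b r) : Persists L b r y := by
  obtain ⟨z, hz, hyz⟩ := exists_lt_of_lt_csSup ⟨y', H⟩ h'
  exact hL.persists_anti hz h hyz.le

theorem lt_death (v : Row L) : v.1.1 < death L v.1.1 v.1.2 := by
  obtain ⟨y, hy⟩ := v.2
  exact hy.1.trans_le (hL.le_death hy)

/-- The `max` in `rowPoint` only makes the definition total; it is never active for a rank function.
-/
theorem rowPoint_eq (v : Row L) :
    rowPoint L v = .finite v.1.1 (death L v.1.1 v.1.2) (hL.lt_death v).le := by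
  simp only [rowPoint, max_eq_right (hL.lt_death v).le]

theorem death_eq_iff {b d : ℝ} {r : ℕ} (h : b < d) :
    (∃ y, Persists L b r y) ∧ death L b r = d ↔
      (∀ y, b < y → y < d → Persists L b r y) ∧ ∀ y, d < y → ¬ Persists L b r y := by
  constructor
  · rintro ⟨⟨y', H⟩, rfl⟩
    exact ⟨fun y h₁ h₂ => hL.persists_of_lt_death H h₁ h₂,
      fun y h₁ h₂ => (hL.le_death h₂).not_gt h₁⟩
  · rintro ⟨h₁, h₂⟩
    refine ⟨⟨_, h₁ ((b + d) / 2) (by linarith) (by linarith)⟩, le_antisymm ?_ ?_⟩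
    · refine csSup_le ⟨_, h₁ ((b + d) / 2) (by linarith) (by linarith)⟩ fun y hy => ?_
      by_contra! h
      exact h₂ y h hy
    · refine le_of_forall_lt_imp_le_of_dense fun y hy => ?_
      have hm : Persists L b r (max y ((b + d) / 2)) :=
        h₁ _ (lt_max_of_lt_right (by linarith)) (max_lt hy (by linarith))
      exact (le_max_left _ _).trans (hL.le_death hm)

/-- Dropping two side strips shrinks the square to a thin box about the vertical `b`. Its lower side
counts at least the jump at `d - η`, and its upper side exactly the jump at `d + η` once it is thin
enough. -/
theorem jump_sub_jump_le {b d η : ℝ} (hη : 0 < η) (h : b + η < d - η) :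
    (jump L b (d - η) : ℤ) - jump L b (d + η) ≤
      (L (b + η) (d - η) : ℤ) - L (b - η) (d - η) - L (b + η) (d + η) + L (b - η) (d + η) := by
  obtain ⟨η₀, h₁, h₂, h₃⟩ := exists_jump_eq L (show b < d + η by linarith)
  obtain ⟨η', h₄, h₅, h₆⟩ : ∃ η', 0 < η' ∧ η' ≤ η ∧ η' ≤ η₀ :=
    ⟨min η η₀, lt_min hη h₁, min_le_left _ _, min_le_right _ _⟩
  have b₁ := hL.box (show b + η' ≤ b + η by linarith) h (show d - η ≤ d + η by linarith)
  have b₂ := hL.box (show b - η ≤ b - η' by linarith) (show b - η' < d - η by linarith)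
    (show d - η ≤ d + η by linarith)
  have j₁ := jump_le (L := L) h₄ (show b + η' < d - η by linarith)
  have m₀ := hL.mono_left (show b - η' ≤ b + η' by linarith) (show b + η' < d - η by linarith)
  have m₁ := hL.mono_left (show b + η' ≤ b + η₀ by linarith) h₂
  have m₂ := hL.mono_left (show b - η₀ ≤ b - η' by linarith) (show b - η' < d + η by linarith)
  have m₃ := hL.mono_left (show b - η' ≤ b + η' by linarith) (show b + η' < d + η by linarith)
  omega

/-- The jump at `b` is antitone and integer-valued in `y`, hence constant just below `d` (value `q`)
and just above `d` (value `p`). The ranks dying at `d` are those below `q` but not below `p`, and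
small squares about `(b, d)` have sum `q - p`. -/
theorem exists_fibre_eq_Ico {b d : ℝ} (h : b < d) : ∃ p q : ℕ, p ≤ q ∧
    {r | (∃ y, Persists L b r y) ∧ death L b r = d} = Set.Ico p q ∧
    cornerMultiplicity L b d = q - p := by
  obtain ⟨y₁, hb₁, hd₁, hmin⟩ : ∃ y₁, b < y₁ ∧ y₁ < d ∧
      ∀ y, b < y → y < d → jump L b y₁ ≤ jump L b y := by
    obtain ⟨y₁, h₁, h₂, h₃⟩ : sInf {n | ∃ y, b < y ∧ y < d ∧ n = jump L b y} ∈
        {n | ∃ y, b < y ∧ y < d ∧ n = jump L b y} :=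
      Nat.sInf_mem ⟨_, (b + d) / 2, by linarith, by linarith, rfl⟩
    exact ⟨y₁, h₁, h₂, fun y h₄ h₅ => h₃ ▸ Nat.sInf_le ⟨y, h₄, h₅, rfl⟩⟩
  -- The maximum above `d` is found by minimising the deficit from the jump at `d`; the truncated
  -- subtraction is exact by `jump_anti`.
  obtain ⟨y₂, hd₂, hmax⟩ : ∃ y₂, d < y₂ ∧ ∀ y, d < y → jump L b y ≤ jump L b y₂ := by
    obtain ⟨y₂, h₁, h₂⟩ : sInf {n | ∃ y, d < y ∧ n = jump L b d - jump L b y} ∈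
        {n | ∃ y, d < y ∧ n = jump L b d - jump L b y} :=
      Nat.sInf_mem ⟨_, d + 1, by linarith, rfl⟩
    refine ⟨y₂, h₁, fun y hy => ?_⟩
    have h₃ : sInf {n | ∃ y, d < y ∧ n = jump L b d - jump L b y} ≤ jump L b d - jump L b y :=
      Nat.sInf_le ⟨y, hy, rfl⟩
    have := hL.jump_anti h hy.le
    have := hL.jump_anti h h₁.le
    omega
  refine ⟨jump L b y₂, jump L b y₁, hL.jump_anti hb₁ (hd₁.trans hd₂).le, ?_, ?_⟩
  · ext r
    rw [Set.mem_ofPred_eq, hL.death_eq_iff h, Set.mem_Ico]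
    constructor
    · rintro ⟨H₁, H₂⟩
      refine ⟨?_, (persists_iff hb₁).1 (H₁ y₁ hb₁ hd₁)⟩
      have := mt (persists_iff (h.trans hd₂)).2 (H₂ y₂ hd₂)
      omega
    · rintro ⟨H₁, H₂⟩
      refine ⟨fun y h₁ h₂ => (persists_iff h₁).2 (H₂.trans_le (hmin y h₁ h₂)), fun y h₁ h₂ => ?_⟩
      have := (persists_iff h₂.1).1 h₂
      have := hmax y h₁
      omega
  · have hle : ∀ η, 0 < η → b + η < d - η → (jump L b y₁ : ℤ) - jump L b y₂ ≤
        (L (b + η) (d - η) : ℤ) - L (b - η) (d - η) - L (b + η) (d + η) +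
          L (b - η) (d + η) := by
      intro η h₁ h₂
      have := hL.jump_sub_jump_le h₁ h₂
      have := hmin (d - η) (by linarith) (by linarith)
      have := hmax (d + η) (by linarith)
      omega
    -- The lower bound is attained by a square thin enough to realise the jump at `y₁` and low
    -- enough to fit between `y₁` and `y₂`.
    obtain ⟨η₀, h₁, h₂, h₃⟩ := exists_jump_eq L hb₁
    obtain ⟨η, h₀, h₄, h₅, h₆⟩ : ∃ η, 0 < η ∧ η ≤ η₀ ∧ η ≤ d - y₁ ∧ η ≤ y₂ - d :=
      ⟨min η₀ (min (d - y₁) (y₂ - d)), lt_min h₁ (lt_min (by linarith) (by linarith)),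
        min_le_left _ _, (min_le_right _ _).trans (min_le_left _ _),
        (min_le_right _ _).trans (min_le_right _ _)⟩
    have hlt : b + η < d - η := by linarith
    refine IsLeast.csInf_eq ⟨⟨η, h₀, hlt, le_antisymm (hle η h₀ hlt) ?_⟩, ?_⟩
    · have b₁ := hL.box (show b - η ≤ b + η by linarith) (show b + η < y₁ by linarith)
        (show y₁ ≤ d - η by linarith)
      have m₁ := hL.mono_left (show b + η ≤ b + η₀ by linarith) h₂
      have m₂ := hL.mono_left (show b - η₀ ≤ b - η by linarith) (show b - η < y₁ by linarith)
      have m₃ := hL.mono_left (show b - η ≤ b + η by linarith) (show b + η < d + η by linarith)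
      have j₁ := jump_le (L := L) h₀ (show b + η < d + η by linarith)
      have j₂ := hL.jump_anti (show b < d + η by linarith) (show d + η ≤ y₂ by linarith)
      omega
    · rintro n ⟨η, h₁, h₂, rfl⟩
      exact hle η h₁ h₂

theorem ncard_rowPoint_eq {x y : ℝ} (h : x ≤ y) (hxy : x < y) :
    {v | rowPoint L v = .finite x y h}.Finite ∧
      ({v | rowPoint L v = .finite x y h}.ncard : ℤ) = cornerMultiplicity L x y := by
  obtain ⟨p, q, hpq, hset, hm⟩ := hL.exists_fibre_eq_Ico hxy
  have hiff : ∀ v : Row L, rowPoint L v = .finite x y h ↔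
      v.1.1 = x ∧ death L v.1.1 v.1.2 = y := by
    intro v
    rw [hL.rowPoint_eq, ExtPoint.finite.injEq]
  have himg : (fun v : Row L => v.1.2) '' {v | rowPoint L v = .finite x y h} = Set.Ico p q := by
    rw [← hset]
    ext r
    constructor
    · rintro ⟨v, hv, rfl⟩
      obtain ⟨rfl, h₂⟩ := (hiff v).1 hv
      exact ⟨v.2, h₂⟩
    · rintro ⟨h₁, h₂⟩
      exact ⟨⟨(x, r), h₁⟩, (hiff _).2 ⟨rfl, h₂⟩, rfl⟩
  have hinj : Set.InjOn (fun v : Row L => v.1.2) {v | rowPoint L v = .finite x y h} := by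
    intro v hv w hw hvw
    exact Subtype.ext (Prod.ext (((hiff v).1 hv).1.trans ((hiff w).1 hw).1.symm) hvw)
  refine ⟨Set.Finite.of_finite_image (himg ▸ Set.finite_Ico p q) hinj, ?_⟩
  rw [← hinj.ncard_image, himg, hm, Set.ncard_eq_toFinset_card', Set.toFinset_Ico,
    Nat.card_Ico]
  omega

/-- An abscissa `b` carrying a cornerpoint is recovered from a rational `q` below its ordinate and
the value of `L · q` just left of `b`: it is where `L · q` first exceeds that value. -/
theorem countable_row : Countable (Row L) := by
  have hsub : {b | ∃ y, Persists L b 0 y} ⊆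
      Set.range fun s : ℚ × ℕ => sSup {x | x < s.1 ∧ L x s.1 ≤ s.2} := by
    rintro b ⟨y, hy⟩
    obtain ⟨q, h₁, h₂⟩ := exists_rat_btwn hy.1
    have hq := hL.persists_anti hy h₁ h₂.le
    obtain ⟨η, h₃, h₄, h₅⟩ := exists_jump_eq L h₁
    have hpos := (persists_iff h₁).1 hq
    refine ⟨(q, L (b - η) q), ?_⟩
    have hlim : ∀ x, x < b → L x q ≤ L (b - η) q := by
      intro x hx
      rcases le_total x (b - η) with h | h
      · exact hL.mono_left h (by linarith)
      · have := jump_le (L := L) (show 0 < b - x by linarith) (show b + (b - x) < q by linarith)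
        have e : b - (b - x) = x := by ring
        have m₁ := hL.mono_left (show b + (b - x) ≤ b + η by linarith) h₄
        have m₂ := hL.mono_left (show x ≤ b + (b - x) by linarith)
          (show b + (b - x) < q by linarith)
        rw [e] at this
        omega
    refine IsLUB.csSup_eq ⟨?_, ?_⟩ ⟨b - 1, by simp only; linarith,
      hlim _ (by linarith)⟩
    · rintro x ⟨hx, hx'⟩
      by_contra! hbx
      have j := hq.2 (min (x - b) η) (lt_min (by linarith) h₃)
        (by linarith [min_le_right (x - b) η])
      have m₁ : L (b + min (x - b) η) q ≤ L x q :=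
        hL.mono_left (by linarith [min_le_left (x - b) η]) hx
      have m₂ := hL.mono_left
        (show b - η ≤ b - min (x - b) η by linarith [min_le_right (x - b) η])
        (show b - min (x - b) η < q by linarith [lt_min (sub_pos.2 hbx) h₃])
      have hx'' : L x q ≤ L (b - η) q := hx'
      omega
    · intro u hu
      refine le_of_forall_lt_imp_le_of_dense fun x hx => hu ⟨?_, hlim x hx⟩
      exact hx.trans h₁
  have hc : {b | ∃ y, Persists L b 0 y}.Countable := (Set.countable_range _).mono hsub
  have : Countable {b | ∃ y, Persists L b 0 y} := hc
  refine Function.Injective.countable (f := fun v : Row L =>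
    ((⟨v.1.1, v.2.imp fun y hy => (persists_iff hy.1).2
      ((Nat.zero_le _).trans_lt ((persists_iff hy.1).1 hy))⟩, v.1.2) :
      {b | ∃ y, Persists L b 0 y} × ℕ)) ?_
  intro v w hvw
  simp only [Prod.mk.injEq, Subtype.mk.injEq] at hvw
  exact Subtype.ext (Prod.ext hvw.1 hvw.2)

end IsRankFunction

/-! ### Comparison of rank functions -/

/-- If the increments of `L` in the first variable bound those of a translate of `L'` from below
and from above up to a further upwards translation, then the cornerpoints of `L` inject into
those of `L'`, and the ones left over are close to the diagonal. -/
theorem persists_comparison {L L' : ℝ → ℝ → ℕ} (hL : IsRankFunction L) (hL' : IsRankFunction L')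
    {s u : ℝ} (hsu : s ≤ u)
    (h₁ : ∀ x₁ x₂ y, x₁ ≤ x₂ → x₂ < y →
      L x₂ y + L' (x₁ + s) (y + s) ≤ L x₁ y + L' (x₂ + s) (y + s))
    (h₂ : ∀ x₁ x₂ y, x₁ ≤ x₂ → x₂ < y →
      L' (x₂ + s) (y + u) + L x₁ y ≤ L' (x₁ + s) (y + u) + L x₂ y) :
    ∃ f : Row L → Row L', f.Injective ∧
      (∀ v, (f v).1.1 = v.1.1 + s ∧ death L v.1.1 v.1.2 + s ≤ death L' (f v).1.1 (f v).1.2 ∧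
        death L' (f v).1.1 (f v).1.2 ≤ death L v.1.1 v.1.2 + u) ∧
      ∀ w ∉ Set.range f, death L' w.1.1 w.1.2 ≤ w.1.1 + (u - s) := by
  have P₁ : ∀ {b r y}, Persists L b r y → Persists L' (b + s) r (y + s) := by
    rintro b r y ⟨hb, H⟩
    refine ⟨by linarith, fun η hη hy => ?_⟩
    have a := H η hη (by linarith)
    have c := h₁ (b - η) (b + η) y (by linarith) (by linarith)
    rw [sub_add_eq_add_sub, add_right_comm b η s] at c
    omega
  have P₂ : ∀ {b r y}, Persists L' (b + s) r (y + u) → b < y → Persists L b r y := by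
    rintro b r y ⟨-, H⟩ hb
    refine ⟨hb, fun η hη hy => ?_⟩
    have a := H η hη (by linarith)
    have c := h₂ (b - η) (b + η) y (by linarith) (by linarith)
    rw [sub_add_eq_add_sub, add_right_comm b η s] at c
    omega
  -- Translating the abscissa and keeping the rank is injective; `P₁` shows that the image is again
  -- a row.
  refine ⟨fun v => ⟨(v.1.1 + s, v.1.2), v.2.imp' (· + s) fun y hy => P₁ hy⟩, ?_,
    fun v => ⟨rfl, ?_, ?_⟩, fun w hw => ?_⟩
  · intro v v' h
    have h' : ((v.1.1 + s, v.1.2) : ℝ × ℕ) = (v'.1.1 + s, v'.1.2) := congrArg Subtype.val h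
    rw [Prod.mk.injEq, add_left_inj] at h'
    exact Subtype.ext (Prod.ext h'.1 h'.2)
  · obtain ⟨y, hy⟩ := v.2
    rw [← le_sub_iff_add_le]
    refine csSup_le ⟨y, hy⟩ fun z hz => ?_
    rw [le_sub_iff_add_le]
    exact hL'.le_death (P₁ hz)
  · obtain ⟨y, hy⟩ := v.2
    refine csSup_le ⟨_, P₁ hy⟩ fun z hz => ?_
    rw [← sub_le_iff_le_add]
    by_cases h : v.1.1 < z - u
    · exact hL.le_death (P₂ (by rwa [sub_add_cancel]) h)
    -- Here `P₂` does not apply, but `z - u` is already at most the abscissa.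
    · exact (not_lt.1 h).trans (hL.lt_death v).le
  · obtain ⟨y, hy⟩ := w.2
    refine csSup_le ⟨y, hy⟩ fun z hz => ?_
    by_contra! h
    -- A point this far from the diagonal pulls back along `P₂` to a row of `L` mapping to `w`.
    have hz' : Persists L (w.1.1 - s) w.1.2 (z - u) :=
      P₂ (by rwa [sub_add_cancel, sub_add_cancel]) (by linarith)
    exact hw ⟨⟨(w.1.1 - s, w.1.2), _, hz'⟩, Subtype.ext (Prod.ext (sub_add_cancel _ _) rfl)⟩

/-! ### Bijections from fibres, and the pseudo-distance -/

theorem exists_equiv_of_fibres {ι κ Z : Type*} (p : ι → Z) (q : κ → Z)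
    (h : ∀ z, Nonempty ({i | p i = z} ≃ {j | q j = z})) : ∃ e : ι ≃ κ, ∀ i, q (e i) = p i := by
  have E := fun z => (h z).some
  refine ⟨(Equiv.sigmaFiberEquiv p).symm.trans
    ((Equiv.sigmaCongrRight E).trans (Equiv.sigmaFiberEquiv q)), fun i => ?_⟩
  exact (E (p i) ⟨i, rfl⟩).2

theorem nonempty_equiv_of_ncard_eq {ι κ : Type*} {S : Set ι} {T : Set κ} (hS : S.Finite)
    (hT : T.Finite) (h : S.ncard = T.ncard) : Nonempty (S ≃ T) := by
  have := hS.to_subtype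
  have := hT.to_subtype
  exact Finite.card_eq.1 h

namespace ExtPoint

theorem dist_comm (p q : ExtPoint) : p.dist q = q.dist p := by
  cases p <;> cases q <;> simp only [dist, abs_sub_comm]
  rw [max_comm (_ / 2)]

/-- By the triangle inequality the first term of the minimum is at least `(y - x) / 2`, so the
position `t` on the diagonal is irrelevant. -/
theorem dist_diagonal_left (t : ℝ) {x y : ℝ} (h : x ≤ y) :
    (finite t t le_rfl).dist (finite x y h) = ENNReal.ofReal ((y - x) / 2) := by
  rw [dist, sub_self, zero_div, max_eq_right (by linarith : 0 ≤ (y - x) / 2), min_eq_right]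
  have h₁ := le_abs_self (t - x)
  have h₂ := neg_abs_le (t - y)
  have h₃ := le_max_left |t - x| |t - y|
  have h₄ := le_max_right |t - x| |t - y|
  linarith

/-- Identify all points of the diagonal. -/
noncomputable def collapse : ExtPoint → ExtPoint
  | finite x y h => if x = y then finite 0 0 le_rfl else finite x y h
  | infinite k => infinite k

theorem dist_collapse_left (p q : ExtPoint) : p.collapse.dist q = p.dist q := by
  cases p with
  | infinite k => rfl
  | finite x y h =>
    by_cases hxy : x = y
    · subst hxy
      rw [collapse, if_pos rfl]
      cases q with
      | infinite k => rfl
      | finite x' y' h' => rw [dist_diagonal_left, dist_diagonal_left]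
    · rw [collapse, if_neg hxy]

theorem dist_eq_of_collapse_eq {p p' q q' : ExtPoint} (hp : p.collapse = p'.collapse)
    (hq : q.collapse = q'.collapse) : p.dist q = p'.dist q' := by
  rw [← dist_collapse_left, hp, dist_collapse_left, dist_comm, ← dist_collapse_left, hq,
    dist_collapse_left, dist_comm]

theorem collapse_eq_infinite_iff (p : ExtPoint) (k : ℝ) :
    p.collapse = infinite k ↔ p = infinite k := by
  cases p with
  | infinite k' => rfl
  | finite x y h =>
    rw [collapse]
    split_ifs <;> simp

theorem collapse_eq_finite_iff (p : ExtPoint) {x y : ℝ} (h : x ≤ y) (hxy : x < y) :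
    p.collapse = finite x y h ↔ p = finite x y h := by
  cases p with
  | infinite k' => simp [collapse]
  | finite x' y' h' =>
    rw [collapse]
    split_ifs with h₀
    · subst h₀
      simp only [finite.injEq]
      constructor
      · rintro ⟨rfl, rfl⟩
        exact absurd hxy (lt_irrefl _)
      · rintro ⟨rfl, rfl⟩
        exact absurd hxy (lt_irrefl _)
    · rfl

theorem collapse_eq_diagonal_iff (p : ExtPoint) (t : ℝ) :
    p.collapse = finite t t le_rfl ↔ p.OnDiagonal ∧ t = 0 := by
  unfold OnDiagonal
  cases p with
  | infinite k' => simp [collapse]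
  | finite x' y' h' =>
    rw [collapse]
    split_ifs with h₀
    · subst h₀
      simp [eq_comm]
    · simp only [finite.injEq]
      constructor
      · rintro ⟨rfl, rfl⟩
        exact absurd rfl h₀
      · rintro ⟨⟨z, rfl, rfl⟩, -⟩
        exact absurd rfl h₀

/-- The point is finite and at distance at most `c` from the diagonal. -/
def IsNearDiagonal (c : ℝ) (p : ExtPoint) : Prop :=
  ∃ (x y : ℝ) (h : x ≤ y), p = finite x y h ∧ y - x ≤ 2 * c

theorem IsNearDiagonal.dist_le {c : ℝ} {p q : ExtPoint} (hp : p.IsNearDiagonal c)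
    (hq : q.IsNearDiagonal c) : p.dist q ≤ ENNReal.ofReal c := by
  obtain ⟨x, y, h, rfl, hc⟩ := hp
  obtain ⟨x', y', h', rfl, hc'⟩ := hq
  refine ENNReal.ofReal_le_ofReal ((min_le_right _ _).trans (max_le ?_ ?_)) <;> linarith

theorem dist_finite_le {c x y x' y' : ℝ} (h : x ≤ y) (h' : x' ≤ y') (hx : |x - x'| ≤ c)
    (hy : |y - y'| ≤ c) : (finite x y h).dist (finite x' y' h') ≤ ENNReal.ofReal c :=
  ENNReal.ofReal_le_ofReal ((min_le_left _ _).trans (max_le hx hy))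

end ExtPoint

/-! ### Representing families and their matching cost -/

/-- The family `p` consists of `(k, ∞)`, of every point `(x, y)` with `x < y` as often as its
multiplicity says, and of infinitely many points of the diagonal. -/
structure Represents (ℓ : ℝ → ℝ → ℕ) (k : ℝ) {ι : Type*} (p : ι → ExtPoint) : Prop where
  infinite : ∃ i₀, ∀ i k', p i = .infinite k' ↔ i = i₀ ∧ k' = k
  finite : ∀ (x y : ℝ) (h : x ≤ y), x < y → {i | p i = .finite x y h}.Finite ∧
    ({i | p i = .finite x y h}.ncard : ℤ) = cornerMultiplicity ℓ x y
  diagonal : {i | (p i).OnDiagonal}.Infinite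

namespace Represents

variable {ℓ : ℝ → ℝ → ℕ} {k : ℝ} {ι κ : Type*} {p : ι → ExtPoint} {q : κ → ExtPoint}

/-- After collapsing the diagonal, corresponding fibres are finite of equal cardinality, except that
over the diagonal, where both are countably infinite. -/
theorem exists_equiv [Countable ι] [Countable κ] (hp : Represents ℓ k p)
    (hq : Represents ℓ k q) : ∃ e : ι ≃ κ, ∀ i, (q (e i)).collapse = (p i).collapse := by
  refine exists_equiv_of_fibres (fun i => (p i).collapse) (fun j => (q j).collapse) fun z => ?_
  cases z with
  | infinite k' =>
    simp only [ExtPoint.collapse_eq_infinite_iff]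
    obtain ⟨i₀, hi₀⟩ := hp.infinite
    obtain ⟨j₀, hj₀⟩ := hq.infinite
    simp only [hi₀, hj₀]
    by_cases h : k' = k
    · simp only [h, and_true]
      exact nonempty_equiv_of_ncard_eq (Set.finite_singleton i₀) (Set.finite_singleton j₀)
        ((Set.ncard_singleton i₀).trans (Set.ncard_singleton j₀).symm)
    · simp only [h, and_false]
      exact nonempty_equiv_of_ncard_eq (by simp) (by simp) (by simp)
  | finite x y h =>
    rcases h.lt_or_eq with hxy | rfl
    · simp only [ExtPoint.collapse_eq_finite_iff _ h hxy]
      obtain ⟨h₁, h₂⟩ := hp.finite x y h hxy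
      obtain ⟨h₃, h₄⟩ := hq.finite x y h hxy
      exact nonempty_equiv_of_ncard_eq h₁ h₃ (by exact_mod_cast h₂.trans h₄.symm)
    · simp only [ExtPoint.collapse_eq_diagonal_iff]
      by_cases h : x = 0
      · simp only [h, and_true]
        have := hp.diagonal.to_subtype
        have := hq.diagonal.to_subtype
        exact nonempty_equiv_of_countable
      · simp only [h, and_false]
        exact nonempty_equiv_of_ncard_eq (by simp) (by simp) (by simp)

theorem exists_isRepresentativeSequence [Countable ι] (hp : Represents ℓ k p)
    (hk : IsCornerpointAtInfinity ℓ k) : ∃ a, IsRepresentativeSequence ℓ a := by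
  obtain ⟨i₀, hi₀⟩ := hp.infinite
  have : Infinite ι := hp.diagonal.to_subtype.of_injective _ Subtype.val_injective
  obtain ⟨e⟩ : Nonempty (ℕ ≃ ι) := nonempty_equiv_of_countable
  have hswap : ∃ e : ℕ ≃ ι, e 0 = i₀ :=
    ⟨(Equiv.swap 0 (e.symm i₀)).trans e, by simp⟩
  obtain ⟨e, he⟩ := hswap
  have hpre : ∀ S : Set ι, {n | e n ∈ S} = e.symm '' S := fun S => by
    rw [Equiv.image_symm_eq_preimage]; rfl
  refine ⟨fun n => p (e n), ⟨k, hk, (hi₀ _ k).2 ⟨he, rfl⟩⟩, fun n hn => ?_, fun x y h hc => ?_, ?_⟩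
  · rcases hpn : p (e n) with ⟨x, y, h⟩ | k'
    · rcases h.lt_or_eq with hxy | rfl
      · refine Or.inl ⟨x, y, h, ⟨hxy, ?_⟩, rfl⟩
        obtain ⟨h₁, h₂⟩ := hp.finite x y h hxy
        rw [← h₂]
        exact_mod_cast (Set.ncard_pos h₁).2 ⟨e n, hpn⟩
      · exact Or.inr ⟨x, rfl⟩
    · have := ((hi₀ _ _).1 hpn).1
      rw [← he, e.apply_eq_iff_eq] at this
      omega
  · rw [← (hp.finite x y h hc.1).2]
    have := hpre {i | p i = .finite x y h}
    simp only [Set.mem_ofPred_eq] at this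
    rw [this, Set.ncard_image_of_injective _ e.symm.injective]
  · have := hpre {i | (p i).OnDiagonal}
    simp only [Set.mem_ofPred_eq] at this
    rw [this]
    exact hp.diagonal.image e.symm.injective.injOn

end Represents

/-- A representative sequence prescribes counts only at proper cornerpoints; elsewhere off the
diagonal the count is zero, and `hℓ` forces the multiplicity to be zero too. -/
theorem IsRepresentativeSequence.represents {ℓ : ℝ → ℝ → ℕ} {k : ℝ} {a : ℕ → ExtPoint}
    (ha : IsRepresentativeSequence ℓ a) (hk : ∀ k', IsCornerpointAtInfinity ℓ k' → k' = k)
    (hℓ : ∀ x y, x < y → 0 ≤ cornerMultiplicity ℓ x y) : Represents ℓ k a where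
  infinite := by
    obtain ⟨k₀, h₀, h₁⟩ := ha.zero
    obtain rfl := hk k₀ h₀
    refine ⟨0, fun i k' => ⟨fun h => ?_, ?_⟩⟩
    · rcases Nat.eq_zero_or_pos i with rfl | hi
      · rw [h₁, ExtPoint.infinite.injEq] at h
        exact ⟨rfl, h.symm⟩
      · rcases ha.pos i hi with ⟨x, y, h', -, h''⟩ | ⟨x, hx⟩
        · simp [h''] at h
        · simp [hx] at h
    · rintro ⟨rfl, rfl⟩
      exact h₁
  finite x y h hxy := by
    by_cases hc : 0 < cornerMultiplicity ℓ x y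
    · have := ha.card_eq x y h ⟨hxy, hc⟩
      -- An infinite set has `ncard` zero, so a positive count gives finiteness.
      refine ⟨Set.finite_of_ncard_pos ?_, this⟩
      exact_mod_cast this ▸ hc
    · have he : {i | a i = .finite x y h} = ∅ := by
        refine Set.eq_empty_of_forall_notMem fun i hi => ?_
        have hi : a i = .finite x y h := hi
        rcases Nat.eq_zero_or_pos i with rfl | hpos
        · obtain ⟨k₀, -, h₁⟩ := ha.zero
          simp [h₁] at hi
        · rcases ha.pos i hpos with ⟨x', y', h', hp, h''⟩ | ⟨t, ht⟩
          · rw [h'', ExtPoint.finite.injEq] at hi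
            obtain ⟨rfl, rfl⟩ := hi
            exact hc hp.2
          · rw [ht, ExtPoint.finite.injEq] at hi
            exact hxy.ne (hi.1.symm.trans hi.2)
      rw [he]
      refine ⟨Set.finite_empty, ?_⟩
      rw [Set.ncard_empty]
      exact le_antisymm (hℓ x y hxy) (not_lt.1 hc)
  diagonal := ha.diagonal

/-- The matching cost of two families of points. -/
noncomputable def familyMatchingCost {ι κ : Type*} (p : ι → ExtPoint) (q : κ → ExtPoint) :
    ℝ≥0∞ :=
  ⨅ σ : ι ≃ κ, ⨆ i, (p i).dist (q (σ i))

theorem familyMatchingCost_le {ℓ₁ ℓ₂ : ℝ → ℝ → ℕ} {k₁ k₂ : ℝ} {ι ι' κ κ' : Type*} [Countable ι]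
    [Countable ι'] [Countable κ] [Countable κ'] {p : ι → ExtPoint} {p' : ι' → ExtPoint}
    {q : κ → ExtPoint} {q' : κ' → ExtPoint} (hp : Represents ℓ₁ k₁ p) (hp' : Represents ℓ₁ k₁ p')
    (hq : Represents ℓ₂ k₂ q) (hq' : Represents ℓ₂ k₂ q') :
    familyMatchingCost p q ≤ familyMatchingCost p' q' := by
  obtain ⟨e, he⟩ := hp.exists_equiv hp'
  obtain ⟨f, hf⟩ := hq'.exists_equiv hq
  refine le_iInf fun σ => iInf_le_of_le (e.trans (σ.trans f)) (iSup_le fun i => ?_)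
  refine le_trans (le_of_eq ?_) (le_iSup _ (e i))
  exact ExtPoint.dist_eq_of_collapse_eq (he i).symm (hf (σ (e i)))

/-- A partial matching whose unmatched points are near the diagonal extends to a matching of no
larger cost. -/
theorem familyMatchingCost_le_of_partial {ι κ σ : Type*} [Countable ι] [Countable κ]
    {p : ι → ExtPoint} {q : κ → ExtPoint} {f : σ → ι} {g : σ → κ} {c : ℝ}
    (hf : f.Injective) (hg : g.Injective)
    (hfg : ∀ s, (p (f s)).dist (q (g s)) ≤ ENNReal.ofReal c)
    (hp : ∀ i ∉ Set.range f, (p i).IsNearDiagonal c)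
    (hq : ∀ j ∉ Set.range g, (q j).IsNearDiagonal c)
    (hf' : (Set.range f)ᶜ.Infinite) (hg' : (Set.range g)ᶜ.Infinite) :
    familyMatchingCost p q ≤ ENNReal.ofReal c := by
  classical
  have := hf'.to_subtype
  have := hg'.to_subtype
  -- Leftover points are paired arbitrarily: two points near the diagonal are close by the second
  -- term of `dist`.
  obtain ⟨E⟩ : Nonempty (↥(Set.range f)ᶜ ≃ ↥(Set.range g)ᶜ) := nonempty_equiv_of_countable
  let F : Set.range f ≃ Set.range g :=
    (Equiv.ofInjective f hf).symm.trans (Equiv.ofInjective g hg)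
  refine iInf_le_of_le ((Equiv.Set.sumCompl (Set.range f)).symm.trans
    ((Equiv.sumCongr F E).trans (Equiv.Set.sumCompl (Set.range g)))) (iSup_le fun i => ?_)
  by_cases hi : i ∈ Set.range f
  · obtain ⟨s, rfl⟩ := hi
    have : F ⟨f s, s, rfl⟩ = ⟨g s, s, rfl⟩ := by
      simp only [F, Equiv.trans_apply]
      rw [Equiv.ofInjective_symm_apply hf s]
      rfl
    simp only [Equiv.trans_apply]
    rw [Equiv.Set.sumCompl_symm_apply_of_mem (Set.mem_range_self s)]
    simp only [Equiv.sumCongr_apply, Sum.map_inl, Equiv.Set.sumCompl_apply_inl, this]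
    exact hfg s
  · simp only [Equiv.trans_apply]
    rw [Equiv.Set.sumCompl_symm_apply_of_notMem hi]
    simp only [Equiv.sumCongr_apply, Sum.map_inr, Equiv.Set.sumCompl_apply_inr]
    exact (hp i hi).dist_le (hq _ (E ⟨i, hi⟩).2)

/-- The family consisting of `(k, ∞)`, of the points of `f`, and of infinitely many copies of the
origin. -/
def completeFamily {β : Type*} (k : ℝ) (f : β → ExtPoint) : Option (β ⊕ ℕ) → ExtPoint
  | none => .infinite k
  | some (.inl v) => f v
  | some (.inr _) => .finite 0 0 le_rfl

theorem represents_completeFamily {ℓ : ℝ → ℝ → ℕ} {β : Type*} (k : ℝ) {f : β → ExtPoint}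
    (hoff : ∀ v, ∃ (x y : ℝ) (h : x ≤ y), x < y ∧ f v = .finite x y h)
    (hf : ∀ (x y : ℝ) (h : x ≤ y), x < y → {v | f v = .finite x y h}.Finite ∧
      ({v | f v = .finite x y h}.ncard : ℤ) = cornerMultiplicity ℓ x y) :
    Represents ℓ k (completeFamily k f) where
  infinite := by
    refine ⟨none, fun i k' => ?_⟩
    rcases i with _ | v | n
    · simp [completeFamily, eq_comm]
    · obtain ⟨x, y, h, -, e⟩ := hoff v
      simp [completeFamily, e]
    · simp [completeFamily]
  finite x y h hxy := by
    have himg : {i | completeFamily k f i = .finite x y h} =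
        (fun v => some (.inl v)) '' {v | f v = .finite x y h} := by
      ext i
      rcases i with _ | v | n
      · simp [completeFamily]
      · simp [completeFamily]
      · simp only [completeFamily, Set.mem_ofPred_eq, ExtPoint.finite.injEq, Set.mem_image,
          Option.some.injEq, reduceCtorEq, and_false, exists_false, iff_false]
        rintro ⟨rfl, rfl⟩
        exact lt_irrefl _ hxy
    have hinj : Function.Injective (fun v : β => (some (.inl v) : Option (β ⊕ ℕ))) :=
      fun v w h => by simpa using h
    rw [himg, Set.ncard_image_of_injective _ hinj]
    exact ⟨(hf x y h hxy).1.image _, (hf x y h hxy).2⟩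
  diagonal := by
    refine (Set.infinite_range_of_injective (f := fun n : ℕ => (some (.inr n) : Option (β ⊕ ℕ)))
      fun m n h => by simpa using h).mono ?_
    rintro _ ⟨n, rfl⟩
    exact ⟨0, rfl⟩

/-! ### Verticals against horizontals -/

namespace IsRankFunction

variable {L : ℝ → ℝ → ℕ} (hL : IsRankFunction L)
include hL

theorem cornerMultiplicity_nonneg {x y : ℝ} (h : x < y) : 0 ≤ cornerMultiplicity L x y := by
  rw [← (hL.ncard_rowPoint_eq h.le h).2]
  exact Int.natCast_nonneg _

theorem ncard_reflect_rowPoint_eq {x y : ℝ} (h : x ≤ y) (hxy : x < y) :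
    {v | (rowPoint (SizeTheory.reflect L) v).reflect = .finite x y h}.Finite ∧
      ({v | (rowPoint (SizeTheory.reflect L) v).reflect = .finite x y h}.ncard : ℤ) =
        cornerMultiplicity L x y := by
  simp only [ExtPoint.reflect_eq_iff]
  rw [← cornerMultiplicity_reflect]
  exact hL.reflect.ncard_rowPoint_eq _ (neg_lt_neg hxy)

theorem rowPoint_off_diagonal (v : Row L) :
    ∃ (x y : ℝ) (h : x ≤ y), x < y ∧ rowPoint L v = .finite x y h :=
  ⟨_, _, _, hL.lt_death v, hL.rowPoint_eq v⟩

theorem reflect_rowPoint_off_diagonal (v : Row (SizeTheory.reflect L)) :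
    ∃ (x y : ℝ) (h : x ≤ y), x < y ∧
      (rowPoint (SizeTheory.reflect L) v).reflect = .finite x y h := by
  obtain ⟨x, y, h, hxy, e⟩ := hL.reflect.rowPoint_off_diagonal v
  exact ⟨-y, -x, neg_le_neg h, neg_lt_neg hxy, by rw [e]; rfl⟩

/-- Enumerating the cornerpoints by verticals or by horizontals gives the same family. -/
theorem exists_row_equiv_reflect : ∃ w : Row L ≃ Row (SizeTheory.reflect L),
    ∀ v, (rowPoint (SizeTheory.reflect L) (w v)).reflect = rowPoint L v := by
  refine exists_equiv_of_fibres (rowPoint L)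
    (fun v => (rowPoint (SizeTheory.reflect L) v).reflect) fun z => ?_
  by_cases hz : ∃ (x y : ℝ) (h : x ≤ y), x < y ∧ z = .finite x y h
  · obtain ⟨x, y, h, hxy, rfl⟩ := hz
    obtain ⟨h₁, h₂⟩ := hL.ncard_rowPoint_eq h hxy
    obtain ⟨h₃, h₄⟩ := hL.ncard_reflect_rowPoint_eq h hxy
    exact nonempty_equiv_of_ncard_eq h₁ h₃ (by exact_mod_cast h₂.trans h₄.symm)
  · have e₁ : {v | rowPoint L v = z} = ∅ :=
      Set.eq_empty_of_forall_notMem fun v hv => hz (hv ▸ hL.rowPoint_off_diagonal v)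
    have e₂ : {v | (rowPoint (SizeTheory.reflect L) v).reflect = z} = ∅ :=
      Set.eq_empty_of_forall_notMem fun v hv => hz (hv ▸ hL.reflect_rowPoint_off_diagonal v)
    rw [e₁, e₂]
    exact nonempty_equiv_of_ncard_eq Set.finite_empty Set.finite_empty (by simp)

end IsRankFunction

/-- The copies of the origin stay unmatched, which supplies the infinite complements needed in
`familyMatchingCost_le_of_partial`. -/
theorem infinite_compl_range_map_inl {α β : Type*} (f : α → β) :
    (Set.range (Option.map fun v => (Sum.inl (f v) : β ⊕ ℕ)))ᶜ.Infinite := by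
  refine (Set.infinite_range_of_injective (f := fun n : ℕ => (some (.inr n) : Option (β ⊕ ℕ)))
    fun m n h => by simpa using h).mono ?_
  rintro _ ⟨n, rfl⟩ ⟨_ | v, hv⟩ <;> simp at hv

theorem completeFamily_isNearDiagonal {α β : Type*} {k c : ℝ} (hc : 0 ≤ c) {p : β → ExtPoint}
    (f : α → β) (hp : ∀ v ∉ Set.range f, (p v).IsNearDiagonal c) :
    ∀ i ∉ Set.range (Option.map fun v => (Sum.inl (f v) : β ⊕ ℕ)),
      (completeFamily k p i).IsNearDiagonal c := by
  rintro (_ | v | n) hi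
  · exact (hi ⟨none, rfl⟩).elim
  · exact hp v fun ⟨u, hu⟩ => hi ⟨some u, by simp [hu]⟩
  · exact ⟨0, 0, le_rfl, rfl, by linarith⟩

/-! ### Size functions of continuous functions -/

section Topology

variable {M : Type*} [TopologicalSpace M]

theorem reducedSizeFunction_eq_zero {φ : M → ℝ} {x : ℝ} (hx : ∀ P, x < φ P) (y : ℝ) :
    reducedSizeFunction φ x y = 0 := by
  have : sublevelClasses φ x y = ∅ :=
    Set.eq_empty_of_forall_notMem fun c ⟨P, hP, _⟩ => (hx P).not_ge hP
  rw [reducedSizeFunction, this, Set.ncard_empty]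

theorem excess_eq_zero_of_lt {φ : M → ℝ} (ψ : M → ℝ) {x : ℝ} (hx : ∀ P, x < φ P) (y : ℝ) :
    excess φ ψ x y = 0 := by
  have : {P | φ P ≤ x} = ∅ := Set.eq_empty_of_forall_notMem fun P hP => (hx P).not_ge hP
  simp [excess, excessComponents, this]

theorem excess_eq_zero_of_le [PreconnectedSpace M] (φ : M → ℝ) {ψ : M → ℝ} (x : ℝ) {y : ℝ}
    (hy : ∀ P, ψ P ≤ y) : excess φ ψ x y = 0 := by
  have hF : {P | ψ P ≤ y} = Set.univ := Set.eq_univ_of_forall hy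
  have hsub : connectedComponentIn Set.univ '' {P | φ P ≤ x} ⊆ {Set.univ} := by
    rintro _ ⟨P, -, rfl⟩
    rw [connectedComponentIn_univ, PreconnectedSpace.connectedComponent_eq_univ]
    rfl
  have := Set.ncard_le_ncard hsub
  rw [Set.ncard_singleton] at this
  rw [excess, excessComponents, hF]
  omega

variable [CompactSpace M]

theorem exists_forall_le_of_continuous [Nonempty M] {φ : M → ℝ} (hφ : Continuous φ) :
    ∃ P₀, ∀ P, φ P₀ ≤ φ P := by
  obtain ⟨P₀, -, h⟩ := isCompact_univ.exists_isMinOn Set.univ_nonempty hφ.continuousOn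
  exact ⟨P₀, fun P => h (Set.mem_univ P)⟩

variable [LocallyConnectedSpace M]

theorem reducedSizeFunction_eq_excess_add_one {φ : M → ℝ} (hφ : Continuous φ) {x y : ℝ}
    (hxy : x < y) {P : M} (hP : φ P ≤ x) :
    reducedSizeFunction φ x y = excess φ φ x y + 1 := by
  rw [reducedSizeFunction_eq_ncard hφ hxy, excess, excessComponents, Nat.sub_add_cancel]
  refine (Set.ncard_pos (finite_components_sublevel hφ hφ fun P hP => hP.trans_lt hxy)).2 ?_
  exact ⟨_, P, hP, rfl⟩

theorem reducedSizeFunction_sub {φ : M → ℝ} (hφ : Continuous φ) {x y y' : ℝ} (h : x < y)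
    (h' : x < y') : (reducedSizeFunction φ x y : ℤ) - reducedSizeFunction φ x y' =
      excess φ φ x y - excess φ φ x y' := by
  by_cases hx : ∃ P, φ P ≤ x
  · obtain ⟨P, hP⟩ := hx
    rw [reducedSizeFunction_eq_excess_add_one hφ h hP,
      reducedSizeFunction_eq_excess_add_one hφ h' hP]
    omega
  · push Not at hx
    simp only [reducedSizeFunction_eq_zero hx, excess_eq_zero_of_lt φ hx]

/-- The square sum is a difference of two vertical differences, in each of which the discount of one
cancels. -/
theorem cornerMultiplicity_reducedSizeFunction {φ : M → ℝ} (hφ : Continuous φ) (x y : ℝ) :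
    cornerMultiplicity (reducedSizeFunction φ) x y = cornerMultiplicity (excess φ φ) x y := by
  unfold cornerMultiplicity
  congr 1
  ext n
  refine exists_congr fun ε => and_congr_right fun h₀ => and_congr_right fun h => ?_
  have h₁ := reducedSizeFunction_sub hφ h (show x + ε < y + ε by linarith)
  have h₂ := reducedSizeFunction_sub hφ (show x - ε < y - ε by linarith)
    (show x - ε < y + ε by linarith)
  omega

variable [ConnectedSpace M]

theorem isRankFunction_excess {φ ψ : M → ℝ} (hφ : Continuous φ) (hψ : Continuous ψ)
    (h : ∀ P, ψ P ≤ φ P) : IsRankFunction (excess φ ψ) where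
  box {x₁ x₂ y₁ y₂} h₁ h₂ h₃ := by
    refine excessComponents_add_le (fun P (hP : φ P ≤ x₁) => hP.trans h₁)
      (fun P (hP : φ P ≤ x₂) => (h P).trans (hP.trans h₂.le))
      (fun P (hP : ψ P ≤ y₁) => hP.trans h₃)
      (finite_components_sublevel hφ hψ fun P hP => (h P).trans_lt (hP.trans_lt h₂))
  lower := by
    obtain ⟨A, hA⟩ := (isCompact_range hφ).bddBelow
    exact ⟨A, fun x y _ hx => excess_eq_zero_of_lt ψ (fun P => hx.trans_le (hA ⟨P, rfl⟩)) y⟩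
  upper := by
    obtain ⟨B, hB⟩ := (isCompact_range hψ).bddAbove
    exact ⟨B, fun x y _ hy => excess_eq_zero_of_le φ x fun P => (hB ⟨P, rfl⟩).trans hy.le⟩

/-- Away from the minimum of `φ`, a small `η` with `1 / η` above the maximum makes both values 0 or
both 1. At the minimum, the left value is always 0 and the right one positive. -/
theorem isCornerpointAtInfinity_iff {φ : M → ℝ} (hφ : Continuous φ) {P₀ : M}
    (hP₀ : ∀ P, φ P₀ ≤ φ P) (k : ℝ) :
    IsCornerpointAtInfinity (reducedSizeFunction φ) k ↔ k = φ P₀ := by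
  obtain ⟨B, hB⟩ := (isCompact_range hφ).bddAbove
  replace hB : ∀ P, φ P ≤ B := fun P => hB ⟨P, rfl⟩
  have small : ∀ δ : ℝ, 0 < δ → ∃ η, 0 < η ∧ k + η < 1 / η ∧ η < δ ∧ B ≤ 1 / η := by
    intro δ hδ
    have hpos : 0 < |k| + |B| + 2 + 2 / δ := by positivity
    have h2 : 0 < 2 / δ := by positivity
    refine ⟨1 / (|k| + |B| + 2 + 2 / δ), by positivity, ?_, ?_, ?_⟩
    · have : 1 / (|k| + |B| + 2 + 2 / δ) ≤ 1 := by
        rw [div_le_one hpos]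
        linarith [abs_nonneg k, abs_nonneg B]
      rw [one_div_one_div]
      linarith [le_abs_self k, abs_nonneg B]
    · rw [div_lt_iff₀ hpos]
      have : δ * (2 / δ) = 2 := by field_simp
      nlinarith [abs_nonneg k, abs_nonneg B]
    · rw [one_div_one_div]
      linarith [le_abs_self B, abs_nonneg k]
  unfold IsCornerpointAtInfinity multiplicityAtInfinity
  constructor
  · intro hk
    by_contra hne
    obtain ⟨η, h₁, h₂, h₃, h₄⟩ := small |k - φ P₀| (abs_pos.2 (sub_ne_zero.2 hne))
    have hmem : (0 : ℤ) ∈ {n : ℤ | ∃ ε : ℝ, 0 < ε ∧ k + ε < 1 / ε ∧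
        n = (reducedSizeFunction φ (k + ε) (1 / ε) : ℤ) -
          reducedSizeFunction φ (k - ε) (1 / ε)} := by
      refine ⟨η, h₁, h₂, ?_⟩
      rcases lt_or_gt_of_ne hne with h | h
      · rw [abs_of_neg (by linarith)] at h₃
        rw [reducedSizeFunction_eq_zero (fun P => by linarith [hP₀ P]),
          reducedSizeFunction_eq_zero (fun P => by linarith [hP₀ P])]
        rfl
      · rw [abs_of_pos (by linarith)] at h₃
        rw [reducedSizeFunction_eq_excess_add_one hφ h₂ (P := P₀) (by linarith),
          reducedSizeFunction_eq_excess_add_one hφ (show k - η < 1 / η by linarith) (P := P₀)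
            (by linarith),
          excess_eq_zero_of_le φ _ fun P => (hB P).trans h₄,
          excess_eq_zero_of_le φ _ fun P => (hB P).trans h₄]
        rfl
    -- If the set were unbounded below, its `sInf` in `ℤ` would be the default 0, again not
    -- positive.
    by_cases hbdd : BddBelow {n : ℤ | ∃ ε : ℝ, 0 < ε ∧ k + ε < 1 / ε ∧
        n = (reducedSizeFunction φ (k + ε) (1 / ε) : ℤ) -
          reducedSizeFunction φ (k - ε) (1 / ε)}
    · exact (csInf_le hbdd hmem).not_gt hk
    · rw [Int.csInf_of_not_bddBelow hbdd] at hk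
      exact lt_irrefl _ hk
  · rintro rfl
    obtain ⟨η, h₁, h₂, -⟩ := small 1 one_pos
    refine Int.lt_iff_add_one_le.2 (le_csInf ⟨_, η, h₁, h₂, rfl⟩ ?_)
    rintro n ⟨ε, h₁, h₂, rfl⟩
    rw [reducedSizeFunction_eq_excess_add_one hφ h₂ (P := P₀) (by linarith),
      reducedSizeFunction_eq_zero (fun P => by linarith [hP₀ P])]
    omega

theorem IsRepresentativeSequence.represents_reducedSizeFunction {φ : M → ℝ} (hφ : Continuous φ)
    {P₀ : M} (hP₀ : ∀ P, φ P₀ ≤ φ P) {a : ℕ → ExtPoint}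
    (ha : IsRepresentativeSequence (reducedSizeFunction φ) a) :
    Represents (reducedSizeFunction φ) (φ P₀) a :=
  ha.represents (fun k' => (isCornerpointAtInfinity_iff hφ hP₀ k').1) fun x y hxy => by
    rw [cornerMultiplicity_reducedSizeFunction hφ]
    exact (isRankFunction_excess hφ hφ fun _ => le_rfl).cornerMultiplicity_nonneg hxy

theorem represents_rowPoint {φ : M → ℝ} (hφ : Continuous φ) (k : ℝ) :
    Represents (reducedSizeFunction φ) k (completeFamily k (rowPoint (excess φ φ))) := by
  have hL := isRankFunction_excess hφ hφ fun _ => le_rfl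
  refine represents_completeFamily k hL.rowPoint_off_diagonal fun x y h hxy => ?_
  rw [cornerMultiplicity_reducedSizeFunction hφ]
  exact hL.ncard_rowPoint_eq h hxy

theorem represents_reflect_rowPoint {φ : M → ℝ} (hφ : Continuous φ) (k : ℝ) :
    Represents (reducedSizeFunction φ) k
      (completeFamily k fun v => (rowPoint (reflect (excess φ φ)) v).reflect) := by
  have hL := isRankFunction_excess hφ hφ fun _ => le_rfl
  refine represents_completeFamily k hL.reflect_rowPoint_off_diagonal fun x y h hxy => ?_
  rw [cornerMultiplicity_reducedSizeFunction hφ]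
  exact hL.ncard_reflect_rowPoint_eq h hxy

theorem exists_isRepresentativeSequence {φ : M → ℝ} (hφ : Continuous φ) :
    ∃ a, IsRepresentativeSequence (reducedSizeFunction φ) a := by
  have hL := isRankFunction_excess hφ hφ fun _ => le_rfl
  have := hL.countable_row
  obtain ⟨P₀, hP₀⟩ := exists_forall_le_of_continuous hφ
  exact (represents_rowPoint hφ (φ P₀)).exists_isRepresentativeSequence
    ((isCornerpointAtInfinity_iff hφ hP₀ _).2 rfl)

/-! ### The mixed count and the stability estimate -/

/-- The cornerpoints of the mixed count of the components of `{ψ - ε ≤ y}` met by `{φ ≤ x}`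
inject, by verticals, into those of `φ`. -/
theorem exists_row_injection {φ ψ : M → ℝ} (hφ : Continuous φ) (hψ : Continuous ψ) {ε : ℝ}
    (hε : 0 ≤ ε) (h : ∀ P, |φ P - ψ P| ≤ ε) :
    ∃ f : Row (excess φ fun P => ψ P - ε) → Row (excess φ φ), f.Injective ∧
      (∀ v, (f v).1.1 = v.1.1 + 0 ∧
        death (excess φ fun P => ψ P - ε) v.1.1 v.1.2 + 0 ≤
          death (excess φ φ) (f v).1.1 (f v).1.2 ∧
        death (excess φ φ) (f v).1.1 (f v).1.2 ≤
          death (excess φ fun P => ψ P - ε) v.1.1 v.1.2 + 2 * ε) ∧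
      ∀ w ∉ Set.range f, death (excess φ φ) w.1.1 w.1.2 ≤ w.1.1 + (2 * ε - 0) := by
  have hψ' : Continuous fun P => ψ P - ε := hψ.sub continuous_const
  have hle : ∀ P, ψ P - ε ≤ φ P := fun P => by linarith [(abs_le.1 (h P)).1]
  have hge : ∀ P, φ P ≤ ψ P + ε := fun P => by linarith [(abs_le.1 (h P)).2]
  -- The set `{φ ≤ x}` is common to both counts and only the larger set changes, within `{φ ≤ y} ⊆
  -- {ψ - ε ≤ y} ⊆ {φ ≤ y + 2ε}`; hence shifts 0 and `2ε`.
  refine persists_comparison (isRankFunction_excess hφ hψ' hle)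
    (isRankFunction_excess hφ hφ fun _ => le_rfl) (by positivity) ?_ ?_
  · intro x₁ x₂ y h₁ h₂
    simp only [add_zero]
    have := excessComponents_add_le (X := {P | φ P ≤ x₁}) (Y := {P | φ P ≤ x₂})
      (F := {P | φ P ≤ y}) (G := {P | ψ P - ε ≤ y})
      (fun P (hP : φ P ≤ x₁) => hP.trans h₁) (fun P (hP : φ P ≤ x₂) => hP.trans h₂.le)
      (fun P (hP : φ P ≤ y) => (hle P).trans hP)
      (finite_components_sublevel hφ hφ fun P hP => hP.trans_lt h₂)
    simp only [excess]
    omega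
  · intro x₁ x₂ y h₁ h₂
    simp only [add_zero]
    have := excessComponents_add_le (X := {P | φ P ≤ x₁}) (Y := {P | φ P ≤ x₂})
      (F := {P | ψ P - ε ≤ y}) (G := {P | φ P ≤ y + 2 * ε})
      (fun P (hP : φ P ≤ x₁) => hP.trans h₁)
      (fun P (hP : φ P ≤ x₂) => (hle P).trans (hP.trans h₂.le))
      (fun P (hP : ψ P - ε ≤ y) => show φ P ≤ y + 2 * ε by linarith [hge P])
      (finite_components_sublevel hφ hψ' fun P hP => (hle P).trans_lt (hP.trans_lt h₂))
    simp only [excess]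
    omega

/-- The cornerpoints of the mixed count of the components of `{ψ - ε ≤ y}` met by `{φ ≤ x}`
inject, by horizontals, into those of `ψ`. -/
theorem exists_reflect_row_injection {φ ψ : M → ℝ} (hφ : Continuous φ) (hψ : Continuous ψ)
    {ε : ℝ} (hε : 0 ≤ ε) (h : ∀ P, |φ P - ψ P| ≤ ε) :
    ∃ g : Row (reflect (excess φ fun P => ψ P - ε)) → Row (reflect (excess ψ ψ)), g.Injective ∧
      (∀ v, (g v).1.1 = v.1.1 + -ε ∧
        death (reflect (excess φ fun P => ψ P - ε)) v.1.1 v.1.2 + -ε ≤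
          death (reflect (excess ψ ψ)) (g v).1.1 (g v).1.2 ∧
        death (reflect (excess ψ ψ)) (g v).1.1 (g v).1.2 ≤
          death (reflect (excess φ fun P => ψ P - ε)) v.1.1 v.1.2 + ε) ∧
      ∀ w ∉ Set.range g, death (reflect (excess ψ ψ)) w.1.1 w.1.2 ≤ w.1.1 + (ε - -ε) := by
  have hψ' : Continuous fun P => ψ P - ε := hψ.sub continuous_const
  have hle : ∀ P, ψ P - ε ≤ φ P := fun P => by linarith [(abs_le.1 (h P)).1]
  have hge : ∀ P, φ P ≤ ψ P + ε := fun P => by linarith [(abs_le.1 (h P)).2]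
  have hset : ∀ y, {P | ψ P ≤ -(y + -ε)} = {P | ψ P - ε ≤ -y} := fun y => by
    ext P
    simp only [Set.mem_ofPred_eq]
    constructor <;> intro hP <;> linarith
  -- Now the larger set is common, by `hset`, and the smaller one changes: `{ψ ≤ x - ε} ⊆ {φ ≤ x} ⊆
  -- {ψ ≤ x + ε}`. Reflection turns this into the shifts `-ε` and `ε`.
  refine persists_comparison (isRankFunction_excess hφ hψ' hle).reflect
    (isRankFunction_excess hψ hψ fun _ => le_rfl).reflect (by linarith) ?_ ?_
  · intro x₁ x₂ y h₁ h₂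
    have := excessComponents_add_le (X := {P | φ P ≤ -y}) (Y := {P | ψ P ≤ -(y + -ε)})
      (F := {P | ψ P - ε ≤ -x₂}) (G := {P | ψ P - ε ≤ -x₁})
      (fun P (hP : φ P ≤ -y) => show ψ P ≤ -(y + -ε) by linarith [hle P])
      (fun P (hP : ψ P ≤ -(y + -ε)) => show ψ P - ε ≤ -x₂ by linarith)
      (fun P (hP : ψ P - ε ≤ -x₂) => hP.trans (neg_le_neg h₁))
      (finite_components_sublevel hψ hψ' fun P hP => by linarith)
    simp only [reflect, excess, hset] at this ⊢
    omega
  · intro x₁ x₂ y h₁ h₂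
    have := excessComponents_add_le (X := {P | ψ P ≤ -(y + ε)}) (Y := {P | φ P ≤ -y})
      (F := {P | ψ P - ε ≤ -x₂}) (G := {P | ψ P - ε ≤ -x₁})
      (fun P (hP : ψ P ≤ -(y + ε)) => show φ P ≤ -y by linarith [hge P])
      (fun P (hP : φ P ≤ -y) => show ψ P - ε ≤ -x₂ by linarith [hle P])
      (fun P (hP : ψ P - ε ≤ -x₂) => hP.trans (neg_le_neg h₁))
      (finite_components_sublevel hφ hψ' fun P hP => by linarith [hle P])
    simp only [reflect, excess, hset] at this ⊢
    omega

theorem familyMatchingCost_rowPoint_le {φ ψ : M → ℝ} (hφ : Continuous φ) (hψ : Continuous ψ)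
    {ε : ℝ} (hε : 0 ≤ ε) (h : ∀ P, |φ P - ψ P| ≤ ε) {P₁ P₂ : M} (hP₁ : ∀ P, φ P₁ ≤ φ P)
    (hP₂ : ∀ P, ψ P₂ ≤ ψ P) :
    familyMatchingCost (completeFamily (φ P₁) (rowPoint (excess φ φ)))
      (completeFamily (ψ P₂) fun v => (rowPoint (reflect (excess ψ ψ)) v).reflect) ≤
        ENNReal.ofReal ε := by
  have hL₁ := isRankFunction_excess hφ hφ fun _ => le_rfl
  have hL₂ := (isRankFunction_excess hψ hψ fun _ => le_rfl).reflect
  have hL := isRankFunction_excess (ψ := fun P => ψ P - ε) hφ (hψ.sub continuous_const) fun P =>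
    show ψ P - ε ≤ φ P by linarith [(abs_le.1 (h P)).1]
  have := hL₁.countable_row
  have := hL₂.countable_row
  obtain ⟨f, hf, hfv, hf'⟩ := exists_row_injection hφ hψ hε h
  obtain ⟨g, hg, hgv, hg'⟩ := exists_reflect_row_injection hφ hψ hε h
  obtain ⟨w, hw⟩ := hL.exists_row_equiv_reflect
  refine familyMatchingCost_le_of_partial (f := Option.map fun v => Sum.inl (f v))
    (g := Option.map fun v => Sum.inl (g (w v)))
    (Option.map_injective (Sum.inl_injective.comp hf))
    (Option.map_injective (Sum.inl_injective.comp (hg.comp w.injective))) ?_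
    (completeFamily_isNearDiagonal hε f fun v hv => ?_)
    (completeFamily_isNearDiagonal hε (fun v => g (w v)) fun v hv => ?_)
    (infinite_compl_range_map_inl _) (infinite_compl_range_map_inl _)
  · rintro (_ | v)
    -- Each minimum is compared with the value of the other function at its minimiser.
    · refine ENNReal.ofReal_le_ofReal (abs_le.2 ⟨?_, ?_⟩)
      · linarith [hP₂ P₁, (abs_le.1 (h P₁)).1]
      · linarith [hP₁ P₂, (abs_le.1 (h P₂)).2]
    -- The enumeration `w` identifies the vertical and horizontal labels of one mixed cornerpoint,
    -- so the bounds from `f` and `g` refer to the same `(b, d)`.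
    · have hv := hw v
      obtain ⟨a₁, a₂, a₃⟩ := hfv v
      obtain ⟨b₁, b₂, b₃⟩ := hgv (w v)
      rw [hL.reflect.rowPoint_eq, hL.rowPoint_eq, ExtPoint.reflect, ExtPoint.finite.injEq] at hv
      simp only [Option.map_some, completeFamily]
      rw [hL₁.rowPoint_eq, hL₂.rowPoint_eq]
      refine ExtPoint.dist_finite_le _ _ (abs_le.2 ⟨?_, ?_⟩) (abs_le.2 ⟨?_, ?_⟩) <;> linarith
  · exact ⟨_, _, _, hL₁.rowPoint_eq v, by linarith [hf' v hv]⟩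
  · refine ⟨_, _, _, by rw [hL₂.rowPoint_eq v]; rfl, ?_⟩
    have := hg' v fun ⟨u, hu⟩ => hv ⟨w.symm u, by simpa using hu⟩
    linarith

end Topology

end SizeTheory

open SizeTheory in
theorem theorem4p1 {M : Type*} [TopologicalSpace M] [CompactSpace M] [ConnectedSpace M]
    [LocallyConnectedSpace M] [T2Space M] (φ : M → ℝ) (hφ : Continuous φ)
    (ε : ℝ) (hε : 0 ≤ ε) (ψ : M → ℝ) (hψ : Continuous ψ)
    (h : ∀ P, |φ P - ψ P| ≤ ε) :
    ∃ r : ℝ≥0,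
      SizeTheory.IsMatchingDistance (SizeTheory.reducedSizeFunction φ)
        (SizeTheory.reducedSizeFunction ψ) r ∧ (r : ℝ) ≤ ε := by
  obtain ⟨P₁, hP₁⟩ := exists_forall_le_of_continuous hφ
  obtain ⟨P₂, hP₂⟩ := exists_forall_le_of_continuous hψ
  have := (isRankFunction_excess hφ hφ fun _ => le_rfl).countable_row
  have := (isRankFunction_excess hψ hψ fun _ => le_rfl).reflect.countable_row
  have hcost := familyMatchingCost_rowPoint_le hφ hψ hε h hP₁ hP₂
  have hp := represents_rowPoint hφ (φ P₁)
  have hq := represents_reflect_rowPoint hψ (ψ P₂)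
  -- The value is the cost between the families listed by verticals for `φ` and by horizontals for
  -- `ψ`, finite by `hcost`.
  refine ⟨ENNReal.toNNReal _, ⟨exists_isRepresentativeSequence hφ,
    exists_isRepresentativeSequence hψ, fun a b ha hb => ?_⟩,
    ENNReal.toReal_le_of_le_ofReal hε hcost⟩
  rw [ENNReal.coe_toNNReal (hcost.trans_lt ENNReal.ofReal_lt_top).ne]
  have ha' := ha.represents_reducedSizeFunction hφ hP₁
  have hb' := hb.represents_reducedSizeFunction hψ hP₂
  exact le_antisymm (familyMatchingCost_le ha' hp hb' hq) (familyMatchingCost_le hp ha' hq hb')
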